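/- All graphs are finite and simple. A graph is called even (respectively, odd) if each of its connected components has an even (respectively, odd) number of vertices; the graph with no vertices is both. For $S\subseteq V(G)$ let $G[S]$ be the subgraph of $G$ induced by $S$. Write $H\sqsubseteq G$ if $H=G[S]$ for some $S\subseteq V(G)$, and $H\sqsubset G$ if $H=G[S]$ for some $S\subsetneq V(G)$; the empty set $S=\emptyset$ is allowed, and sums over $H$ run over the vertex sets $S$. The integers $a(G)$ and $b(G)$ are defined recursively by \[ a(G)=\begin{cases}1&\text{if }V(G)=\emptyset,\\ 0&\text{if }G\text{ is not even},\\ -\sum_{H\sqsubset G}a(H)&\text{otherwise,}\end{cases} \qquad b(G)=\begin{cases}1&\text{if }V(G)=\emptyset,\\ 0&\text{if }G\text{ is not odd},\\ -\sum_{H\sqsubset G}b(H)&\text{otherwise.}\end{cases} \] Then for every graph $G$, \[ b(G)=(-1)^{|V(G)|}\sum_{H\sqsubseteq G}a(H)\qquad\text{and}\qquad a(G)=\sum_{H\sqsubseteq G}b(H). \] So the $a$-numbers and the $b$-numbers determine each other: if $G$ and $G'$ are graphs on the same vertex set $V$, then $a(G[S])=a(G'[S])$ for all $S\subseteq V$ if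 and only if $b(G[S])=b(G'[S])$ for all $S\subseteq V$. -/

import Mathlib

universe u

namespace SimpleGraph

/-- Every connected component has an even number of vertices. -/
def IsEvenGraph {V : Type u} (G : SimpleGraph V) : Prop :=
  ∀ c : G.ConnectedComponent, Even c.supp.ncard

/-- Every connected component has an odd number of vertices. -/
def IsOddGraph {V : Type u} (G : SimpleGraph V) : Prop :=
  ∀ c : G.ConnectedComponent, Odd c.supp.ncard

/-- The subgraph of `G` induced by a finite set `S` of its vertices, as a graph on the type of
elements of `S`. The null graph is the case `S = ∅`. -/
abbrev inducedOn {V : Type u} (G : SimpleGraph V) (S : Finset V) : SimpleGraph {v // v ∈ S} :=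
  G.comap Subtype.val

/-- A proper subset of the vertex set has fewer elements. -/
theorem card_proper_subset_lt {V : Type u} [Fintype V] (S : {S : Finset V // S ⊂ Finset.univ}) :
    Fintype.card {v // v ∈ S.1} < Fintype.card V := by
  rw [Fintype.card_coe]
  exact Finset.card_lt_card S.2

open scoped Classical in
/-- The `a`-number of a finite graph. The sum runs over the proper induced subgraphs,
the null graph included. -/
noncomputable def aNumber {V : Type u} [Fintype V] (G : SimpleGraph V) : ℤ :=
  if IsEmpty V then 1
  else if ¬ G.IsEvenGraph then 0
  else -∑ S : {S : Finset V // S ⊂ Finset.univ}, aNumber (G.inducedOn S.1)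
termination_by Fintype.card V
decreasing_by exact card_proper_subset_lt S

open scoped Classical in
/-- The `b`-number of a finite graph. The sum runs over the proper induced subgraphs,
the null graph included. -/
noncomputable def bNumber {V : Type u} [Fintype V] (G : SimpleGraph V) : ℤ :=
  if IsEmpty V then 1
  else if ¬ G.IsOddGraph then 0
  else -∑ S : {S : Finset V // S ⊂ Finset.univ}, bNumber (G.inducedOn S.1)
termination_by Fintype.card V
decreasing_by exact card_proper_subset_lt S

end SimpleGraph

/-!
Fix `G` and write `a S`, `b S` for the numbers of the subgraph induced by a finite vertex set `S`,
and `A S = ∑ T ⊆ S, a T`. By the recursion, `A S = 0` as soon as `S ≠ ∅` induces an even graph. When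
`C` and `D` are disjoint and no edge joins them, the numbers `a`, and hence the sums `A`, are
multiplicative (`aNumber_inducedOn_union`). If `S` does not induce an odd graph, split off a
component `C` of even order: it is a nonempty even graph by itself, so `A S = A C * A (S \ C) = 0`
(`sum_aNumber_eq_zero_of_not_isOddGraph`).

Put `b' S = (-1) ^ |S| * A S`. Inclusion-exclusion gives `∑ T ⊆ S, b' T = (-1) ^ |S| * a S`, which
equals `a S` since `a` vanishes on sets of odd order. If `S` is nonempty and induces an odd graph,
`a S = 0`, since some component has odd order. So `b'` satisfies the recursion defining `b`, and the
two agree (`bNumber_inducedOn`). Both identities follow.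
-/

namespace SimpleGraph

open Finset

/-! ### Isomorphism invariance and the recursion on finite vertex sets -/

open scoped Classical in
/-- The recursion common to the `a`-number and the `b`-number: `f` is `1` on the null graph, is `0`
off the class `P`, and its sum over all induced subgraphs of a nonnull graph in `P` is `0`. -/
def SatisfiesRecursion (P : ∀ V : Type u, SimpleGraph V → Prop)
    (f : ∀ (V : Type u) [Fintype V], SimpleGraph V → ℤ) : Prop :=
  ∀ (V : Type u) [Fintype V] (G : SimpleGraph V), f V G =
    if IsEmpty V then 1
    else if ¬ P V G then 0
    else -∑ S : {S : Finset V // S ⊂ univ}, f _ (G.inducedOn S.1)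

theorem satisfiesRecursion_aNumber :
    SatisfiesRecursion.{u} (fun _ G => G.IsEvenGraph) (fun _ _ G => G.aNumber) := by
  intro V _ G
  exact aNumber.eq_1 G

theorem satisfiesRecursion_bNumber :
    SatisfiesRecursion.{u} (fun _ G => G.IsOddGraph) (fun _ _ G => G.bNumber) := by
  intro V _ G
  exact bNumber.eq_1 G

theorem Iso.ncard_supp {V W : Type u} {G : SimpleGraph V} {H : SimpleGraph W} (φ : G ≃g H)
    (c : G.ConnectedComponent) : (φ.connectedComponentEquiv c).supp.ncard = c.supp.ncard :=
  (Nat.card_congr (ConnectedComponent.isoEquivSupp φ c)).symm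

theorem Iso.isEvenGraph_iff {V W : Type u} {G : SimpleGraph V} {H : SimpleGraph W} (φ : G ≃g H) :
    G.IsEvenGraph ↔ H.IsEvenGraph := by
  unfold IsEvenGraph
  rw [← φ.connectedComponentEquiv.forall_congr_right (q := fun c => Even c.supp.ncard)]
  simp only [φ.ncard_supp]

theorem Iso.isOddGraph_iff {V W : Type u} {G : SimpleGraph V} {H : SimpleGraph W} (φ : G ≃g H) :
    G.IsOddGraph ↔ H.IsOddGraph := by
  unfold IsOddGraph
  rw [← φ.connectedComponentEquiv.forall_congr_right (q := fun c => Odd c.supp.ncard)]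
  simp only [φ.ncard_supp]

/-- An embedding of graphs restricts to an isomorphism between the subgraph induced by a finite set
and the one induced by its image. -/
noncomputable def Embedding.inducedOnIso {V W : Type u} {G : SimpleGraph V} {H : SimpleGraph W}
    (φ : G ↪g H) (S : Finset V) : G.inducedOn S ≃g H.inducedOn (S.map φ.toEmbedding) where
  toEquiv := Equiv.ofBijective
    (fun v => (⟨φ v, Finset.mem_map_of_mem φ.toEmbedding v.2⟩ : {w // w ∈ S.map φ.toEmbedding}))
    ⟨fun _ _ h => Subtype.ext (φ.injective (congrArg Subtype.val h)), fun ⟨w, hw⟩ => by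
      obtain ⟨v, hv, rfl⟩ := Finset.mem_map.1 hw
      exact ⟨⟨v, hv⟩, rfl⟩⟩
  map_rel_iff' := φ.map_rel_iff'

/-- Every graph is the subgraph induced by its full vertex set. -/
noncomputable def inducedOnUnivIso {V : Type u} [Fintype V] (G : SimpleGraph V) :
    G.inducedOn univ ≃g G where
  toEquiv := Equiv.subtypeUnivEquiv (by simp)
  map_rel_iff' := by simp

/-- Invariance of a class of graphs under isomorphism. -/
def IsoInvariant (P : ∀ V : Type u, SimpleGraph V → Prop) : Prop :=
  ∀ ⦃V W : Type u⦄ ⦃G : SimpleGraph V⦄ ⦃H : SimpleGraph W⦄, (G ≃g H) → (P V G ↔ P W H)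

section Recursion

variable {P : ∀ V : Type u, SimpleGraph V → Prop}
  {f : ∀ (V : Type u) [Fintype V], SimpleGraph V → ℤ}

open scoped Classical in
theorem SatisfiesRecursion.congr (hf : SatisfiesRecursion P f) (hP : IsoInvariant P) :
    ∀ (V W : Type u) [Fintype V] [Fintype W] (G : SimpleGraph V) (H : SimpleGraph W),
      (G ≃g H) → f V G = f W H := by
  suffices h : ∀ (n : ℕ) (V W : Type u) [Fintype V] [Fintype W] (G : SimpleGraph V)
      (H : SimpleGraph W), Fintype.card V = n → (G ≃g H) → f V G = f W H from
    fun V W _ _ G H φ => h _ V W G H rfl φ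
  intro n
  induction n using Nat.strong_induction_on with
  | _ n ih =>
    intro V W _ _ G H hn φ
    rw [hf V G, hf W H]
    by_cases hV : IsEmpty V
    · rw [if_pos hV, if_pos (φ.toEquiv.isEmpty_congr.1 hV)]
    rw [if_neg hV, if_neg (mt φ.toEquiv.isEmpty_congr.2 hV)]
    by_cases hG : P V G
    · rw [if_neg (not_not.2 hG), if_neg (not_not.2 ((hP φ).1 hG))]
      congr 1
      refine Fintype.sum_equiv
        (φ.toEquiv.finsetCongr.subtypeEquiv fun S => ?_) _ _ fun S => ?_
      · rw [← Finset.map_univ_equiv φ.toEquiv]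
        exact Finset.map_ssubset_map.symm
      · exact ih _ (hn ▸ card_proper_subset_lt S) _ _ _ _ rfl (φ.toEmbedding.inducedOnIso S.1)
    · rw [if_pos hG, if_pos (mt (hP φ).2 hG)]

theorem SatisfiesRecursion.inducedOn_empty (hf : SatisfiesRecursion P f) {V : Type u}
    (G : SimpleGraph V) : f _ (G.inducedOn ∅) = 1 := by
  rw [hf, if_pos]
  exact ⟨fun v => Finset.notMem_empty _ v.2⟩

theorem SatisfiesRecursion.inducedOn_eq_zero (hf : SatisfiesRecursion P f) {V : Type u}
    (G : SimpleGraph V) {S : Finset V} (hS : S.Nonempty) (h : ¬ P _ (G.inducedOn S)) :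
    f _ (G.inducedOn S) = 0 := by
  rw [hf, if_neg (not_isEmpty_iff.2 hS.to_subtype), if_pos h]

theorem SatisfiesRecursion.inducedOn_eq_neg_sum (hf : SatisfiesRecursion P f)
    (hP : IsoInvariant P) {V : Type u} [DecidableEq V]
    (G : SimpleGraph V) {S : Finset V} (hS : S.Nonempty) (h : P _ (G.inducedOn S)) :
    f _ (G.inducedOn S) = -∑ T ∈ S.ssubsets, f _ (G.inducedOn T) := by
  rw [hf, if_neg (not_isEmpty_iff.2 hS.to_subtype), if_neg (not_not.2 h)]
  congr 1
  have hS' : (univ : Finset {v // v ∈ S}).map (Function.Embedding.subtype _) = S :=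
    Finset.attach_map_val
  -- The sum carries the classical `Fintype` instance of the recursion, not the inferred one.
  have hmem (inst : Fintype {T : Finset {v // v ∈ S} // T ⊂ univ}) (T) :
      T ∈ @Finset.univ _ inst := @Finset.mem_univ _ inst T
  refine Finset.sum_bij (fun T _ => T.1.map (Function.Embedding.subtype _)) ?_ ?_ ?_ ?_
  · rintro ⟨T, hT⟩ -
    exact Finset.mem_ssubsets.2 ((Finset.map_ssubset_map.2 hT).trans_eq hS')
  · intro T _ T' _ h
    exact Subtype.ext (Finset.map_injective _ h)
  · intro T hT
    rw [Finset.mem_ssubsets] at hT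
    have hmap : (T.subtype (· ∈ S)).map (Function.Embedding.subtype _) = T :=
      Finset.subtype_map_of_mem fun v hv => hT.1 hv
    refine ⟨⟨T.subtype (· ∈ S), ?_⟩, hmem _ _, hmap⟩
    rwa [← Finset.map_ssubset_map (f := Function.Embedding.subtype _), hmap, hS']
  · intro T _
    exact hf.congr hP _ _ _ _
      (Embedding.inducedOnIso (Embedding.comap (Function.Embedding.subtype _) G) T.1)

theorem SatisfiesRecursion.sum_powerset_eq_zero (hf : SatisfiesRecursion P f)
    (hP : IsoInvariant P) {V : Type u} [DecidableEq V]
    (G : SimpleGraph V) {S : Finset V} (hS : S.Nonempty) (h : P _ (G.inducedOn S)) :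
    ∑ T ∈ S.powerset, f _ (G.inducedOn T) = 0 := by
  rw [← Finset.sum_erase_add _ _ (Finset.mem_powerset_self S)]
  have := hf.inducedOn_eq_neg_sum hP G hS h
  rw [Finset.ssubsets] at this
  linarith

end Recursion

theorem isoInvariant_isEvenGraph : IsoInvariant.{u} (fun _ G => G.IsEvenGraph) :=
  fun _ _ _ _ φ => φ.isEvenGraph_iff

theorem isoInvariant_isOddGraph : IsoInvariant.{u} (fun _ G => G.IsOddGraph) :=
  fun _ _ _ _ φ => φ.isOddGraph_iff

/-! ### Even graphs in terms of sets closed under adjacency -/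

variable {V : Type u} (G : SimpleGraph V)

/-- `G.ClosedIn S T`: no edge of `G` joins `T` to a vertex of `S` outside `T`. For `T ⊆ S` this
says that `T` is a union of components of the subgraph induced by `S`. -/
def ClosedIn (S T : Finset V) : Prop :=
  ∀ v ∈ T, ∀ w ∈ S, G.Adj v w → w ∈ T

variable {G}

theorem mem_of_reachable {s : Set V} (hs : ∀ v ∈ s, ∀ w, G.Adj v w → w ∈ s) {v w : V}
    (h : G.Reachable v w) (hv : v ∈ s) : w ∈ s := by
  obtain ⟨p⟩ := h
  induction p with
  | nil => exact hv
  | cons hadj _ ih => exact ih (hs _ hv _ hadj)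

theorem isEvenGraph_iff_forall_even_card [Fintype V] :
    G.IsEvenGraph ↔ ∀ T : Finset V, G.ClosedIn univ T → Even #T := by
  classical
  constructor
  · intro h T hT
    rw [Finset.card_eq_sum_card_fiberwise (f := G.connectedComponentMk)
      (t := T.image G.connectedComponentMk) (fun v hv => Finset.mem_image_of_mem _ hv)]
    refine Finset.even_sum _ fun c hc => ?_
    obtain ⟨v, hv, rfl⟩ := Finset.mem_image.1 hc
    -- A closed set that meets a component contains it, so the fibre is the whole component.
    suffices hs : (↑{w ∈ T | G.connectedComponentMk w = G.connectedComponentMk v} : Set V) =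
        (G.connectedComponentMk v).supp by
      rw [← Set.ncard_coe_finset, hs]
      exact h _
    ext w
    simp only [Finset.coe_filter, Set.mem_ofPred_eq, ConnectedComponent.mem_supp_iff,
      and_iff_right_iff_imp]
    intro hw
    exact mem_of_reachable (s := ↑T) (fun v hv w => hT v hv w (mem_univ w))
      (ConnectedComponent.exact hw).symm hv
  · intro h c
    rw [Set.ncard_eq_toFinset_card']
    refine h _ fun v hv w _ hvw => ?_
    rw [Set.mem_toFinset] at hv ⊢
    exact (c.mem_supp_congr_adj hvw).1 hv

theorem isEvenGraph_inducedOn_iff {S : Finset V} :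
    (G.inducedOn S).IsEvenGraph ↔ ∀ T ⊆ S, G.ClosedIn S T → Even #T := by
  classical
  rw [isEvenGraph_iff_forall_even_card]
  constructor
  · intro h T hTS hT
    have := h (T.subtype (· ∈ S)) fun v hv w _ hvw =>
      Finset.mem_subtype.2 (hT v (Finset.mem_subtype.1 hv) w w.2 hvw)
    rwa [← Finset.card_map (Function.Embedding.subtype _),
      Finset.subtype_map_of_mem fun v hv => hTS hv] at this
  · intro h T hT
    rw [← Finset.card_map (Function.Embedding.subtype _)]
    refine h _ (Finset.map_subtype_subset T) ?_
    intro v hv w hw hvw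
    simp only [Finset.mem_map, Function.Embedding.subtype_apply, Subtype.exists,
      exists_and_right, exists_eq_right] at hv ⊢
    obtain ⟨hvS, hv⟩ := hv
    exact ⟨hw, hT _ hv ⟨w, hw⟩ (mem_univ _) hvw⟩

theorem isEvenGraph_inducedOn_union_iff [DecidableEq V] {C D : Finset V}
    (hCD : Disjoint C D) (h : ∀ v ∈ C, ∀ w ∈ D, ¬ G.Adj v w) :
    (G.inducedOn (C ∪ D)).IsEvenGraph ↔
      (G.inducedOn C).IsEvenGraph ∧ (G.inducedOn D).IsEvenGraph := by
  simp only [isEvenGraph_inducedOn_iff]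
  constructor
  · intro H
    refine ⟨fun T hT hcl => H T (hT.trans subset_union_left) ?_,
      fun T hT hcl => H T (hT.trans subset_union_right) ?_⟩
    · intro v hv w hw hvw
      rcases Finset.mem_union.1 hw with hw | hw
      · exact hcl v hv w hw hvw
      · exact absurd hvw (h v (hT hv) w hw)
    · intro v hv w hw hvw
      rcases Finset.mem_union.1 hw with hw | hw
      · exact absurd hvw.symm (h w hw v (hT hv))
      · exact hcl v hv w hw hvw
  · rintro ⟨hC, hD⟩ T hT hcl
    have hsplit : T = (T ∩ C) ∪ (T ∩ D) := by
      rw [← Finset.inter_union_distrib_left, Finset.inter_eq_left.2 hT]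
    rw [hsplit, Finset.card_union_of_disjoint
      (hCD.mono Finset.inter_subset_right Finset.inter_subset_right)]
    refine (hC _ Finset.inter_subset_right ?_).add (hD _ Finset.inter_subset_right ?_)
    · intro v hv w hw hvw
      exact mem_inter.2 ⟨hcl v (mem_inter.1 hv).1 w (mem_union_left _ hw) hvw, hw⟩
    · intro v hv w hw hvw
      exact mem_inter.2 ⟨hcl v (mem_inter.1 hv).1 w (mem_union_right _ hw) hvw, hw⟩

/-- If the subgraph induced by `S` is not odd, then `S` contains a component of even order; taken
by itself, a connected graph of even order is an even graph. -/
theorem exists_closedIn_of_not_isOddGraph {S : Finset V} (h : ¬ (G.inducedOn S).IsOddGraph) :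
    ∃ C ⊆ S, C.Nonempty ∧ G.ClosedIn S C ∧ (G.inducedOn C).IsEvenGraph := by
  classical
  simp only [IsOddGraph, not_forall, Nat.not_odd_iff_even] at h
  obtain ⟨c, hc⟩ := h
  let C : Finset V := c.supp.toFinset.map (Function.Embedding.subtype _)
  have hmem : ∀ v, v ∈ C ↔ ∃ hv : v ∈ S, (⟨v, hv⟩ : {v // v ∈ S}) ∈ c.supp := by
    intro v
    simp [C]
  have hcard : Even #C := by
    rw [Finset.card_map, ← Set.ncard_eq_toFinset_card']
    exact hc
  have hcl : G.ClosedIn S C := by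
    intro v hv w hw hvw
    obtain ⟨hvS, hv⟩ := (hmem v).1 hv
    exact (hmem w).2 ⟨hw, (c.mem_supp_congr_adj
      (show (G.inducedOn S).Adj ⟨v, hvS⟩ ⟨w, hw⟩ from hvw)).1 hv⟩
  refine ⟨C, fun v hv => ((hmem v).1 hv).1, ?_, hcl, ?_⟩
  · obtain ⟨v, hv⟩ := c.nonempty_supp
    exact ⟨v, (hmem v).2 ⟨v.2, hv⟩⟩
  · rw [isEvenGraph_inducedOn_iff]
    intro T hTC hT
    rcases T.eq_empty_or_nonempty with rfl | ⟨v, hv⟩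
    · simp
    · -- A nonempty closed subset of the component contains everything reachable in it.
      suffices hCT : C ⊆ T by rwa [hTC.antisymm hCT]
      intro w hw
      obtain ⟨hvS, hvc⟩ := (hmem v).1 (hTC hv)
      obtain ⟨hwS, hwc⟩ := (hmem w).1 hw
      have hreach : (G.inducedOn S).Reachable ⟨v, hvS⟩ ⟨w, hwS⟩ := by
        rw [ConnectedComponent.mem_supp_iff] at hvc hwc
        exact ConnectedComponent.exact (hvc.trans hwc.symm)
      refine mem_of_reachable (s := {x : {x // x ∈ S} | x.1 ∈ T}) ?_ hreach hv
      intro x hx y hxy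
      exact hT x hx y (hcl x (hTC hx) y y.2 hxy) hxy

/-! ### Multiplicativity of the `a`-number -/

theorem aNumber_inducedOn_eq_zero_of_not_isEvenGraph {S : Finset V}
    (h : ¬ (G.inducedOn S).IsEvenGraph) : (G.inducedOn S).aNumber = 0 := by
  refine satisfiesRecursion_aNumber.inducedOn_eq_zero G ?_ h
  by_contra hS
  rw [Finset.not_nonempty_iff_eq_empty] at hS
  subst hS
  exact h (isEvenGraph_inducedOn_iff.2 fun T hT _ => by simp [Finset.subset_empty.1 hT])

theorem sum_powerset_union_of_disjoint {M : Type*} [AddCommMonoid M] [DecidableEq V]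
    {C D : Finset V} (hCD : Disjoint C D) (g : Finset V → Finset V → M) :
    ∑ T ∈ (C ∪ D).powerset, g (T ∩ C) (T ∩ D) =
      ∑ X ∈ C.powerset, ∑ Y ∈ D.powerset, g X Y := by
  rw [← Finset.sum_product']
  refine Finset.sum_nbij' (fun T => (T ∩ C, T ∩ D)) (fun p => p.1 ∪ p.2) ?_ ?_ ?_ ?_ ?_
  · intro T _
    simp
  · rintro ⟨X, Y⟩ h
    simp only [mem_product, mem_powerset] at h ⊢
    exact union_subset_union h.1 h.2
  · intro T hT
    rw [mem_powerset] at hT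
    rw [← Finset.inter_union_distrib_left, Finset.inter_eq_left.2 hT]
  · rintro ⟨X, Y⟩ h
    simp only [mem_product, mem_powerset] at h
    have hXD := disjoint_iff_inter_eq_empty.1 (hCD.mono_left h.1)
    have hYC := disjoint_iff_inter_eq_empty.1 (hCD.symm.mono_left h.2)
    simp [union_inter_distrib_right, hXD, hYC, inter_eq_left.2 h.1, inter_eq_left.2 h.2]
  · intro T _
    rfl

theorem aNumber_inducedOn_union [DecidableEq V] {C D : Finset V}
    (hCD : Disjoint C D) (h : ∀ v ∈ C, ∀ w ∈ D, ¬ G.Adj v w) :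
    (G.inducedOn (C ∪ D)).aNumber = (G.inducedOn C).aNumber * (G.inducedOn D).aNumber := by
  induction hn : #(C ∪ D) using Nat.strong_induction_on generalizing C D with
  | _ n ih =>
    have hempty := satisfiesRecursion_aNumber.inducedOn_empty G
    rcases C.eq_empty_or_nonempty with rfl | hC
    · rw [Finset.empty_union, hempty, one_mul]
    by_cases hev : (G.inducedOn (C ∪ D)).IsEvenGraph
    · have hevC := ((isEvenGraph_inducedOn_union_iff hCD h).1 hev).1
      -- The sums of both sides over the subsets of `C ∪ D` vanish, and by induction all terms but
      -- those of `C ∪ D` itself agree.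
      have hl := satisfiesRecursion_aNumber.sum_powerset_eq_zero isoInvariant_isEvenGraph G
        (hC.mono subset_union_left) hev
      have hr : ∑ T ∈ (C ∪ D).powerset,
          (G.inducedOn (T ∩ C)).aNumber * (G.inducedOn (T ∩ D)).aNumber = 0 := by
        rw [sum_powerset_union_of_disjoint hCD
          (fun X Y => (G.inducedOn X).aNumber * (G.inducedOn Y).aNumber), ← Finset.sum_mul_sum,
          satisfiesRecursion_aNumber.sum_powerset_eq_zero isoInvariant_isEvenGraph G hC hevC,
          zero_mul]
      rw [← Finset.sum_erase_add _ _ (mem_powerset_self (C ∪ D))] at hl hr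
      have hcongr : ∑ T ∈ (C ∪ D).powerset.erase (C ∪ D), (G.inducedOn T).aNumber =
          ∑ T ∈ (C ∪ D).powerset.erase (C ∪ D),
            (G.inducedOn (T ∩ C)).aNumber * (G.inducedOn (T ∩ D)).aNumber := by
        refine Finset.sum_congr rfl fun T hT => ?_
        have hT' : T ⊂ C ∪ D := Finset.mem_ssubsets.1 hT
        have hsplit : (T ∩ C) ∪ (T ∩ D) = T := by
          rw [← Finset.inter_union_distrib_left, Finset.inter_eq_left.2 hT'.1]
        have := ih _ (hn ▸ Finset.card_lt_card hT') (C := T ∩ C) (D := T ∩ D)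
          (hCD.mono inter_subset_right inter_subset_right)
          (fun v hv w hw => h v (inter_subset_right hv) w (inter_subset_right hw)) (by rw [hsplit])
        rwa [hsplit] at this
      rw [Finset.inter_eq_right.2 subset_union_left,
        Finset.inter_eq_right.2 subset_union_right] at hr
      linarith
    · rw [aNumber_inducedOn_eq_zero_of_not_isEvenGraph hev]
      rw [isEvenGraph_inducedOn_union_iff hCD h, not_and_or] at hev
      rcases hev with hev | hev
      · rw [aNumber_inducedOn_eq_zero_of_not_isEvenGraph hev, zero_mul]
      · rw [aNumber_inducedOn_eq_zero_of_not_isEvenGraph hev, mul_zero]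

theorem sum_aNumber_eq_zero_of_not_isOddGraph {S : Finset V}
    (h : ¬ (G.inducedOn S).IsOddGraph) : ∑ T ∈ S.powerset, (G.inducedOn T).aNumber = 0 := by
  classical
  obtain ⟨C, hCS, hC, hcl, hev⟩ := exists_closedIn_of_not_isOddGraph h
  have hdisj : Disjoint C (S \ C) := disjoint_sdiff
  have hadj : ∀ v ∈ C, ∀ w ∈ S \ C, ¬ G.Adj v w := fun v hv w hw hvw =>
    (mem_sdiff.1 hw).2 (hcl v hv w (mem_sdiff.1 hw).1 hvw)
  have hmul : ∀ T ∈ (C ∪ S \ C).powerset, (G.inducedOn T).aNumber =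
      (G.inducedOn (T ∩ C)).aNumber * (G.inducedOn (T ∩ (S \ C))).aNumber := by
    intro T hT
    rw [← aNumber_inducedOn_union (hdisj.mono inter_subset_right inter_subset_right)
      (fun v hv w hw => hadj v (inter_subset_right hv) w (inter_subset_right hw)),
      ← Finset.inter_union_distrib_left, Finset.inter_eq_left.2 (mem_powerset.1 hT)]
  rw [← union_sdiff_of_subset hCS, Finset.sum_congr rfl hmul,
    sum_powerset_union_of_disjoint hdisj
      (fun X Y => (G.inducedOn X).aNumber * (G.inducedOn Y).aNumber), ← Finset.sum_mul_sum,
    satisfiesRecursion_aNumber.sum_powerset_eq_zero isoInvariant_isEvenGraph G hC hev, zero_mul]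

/-! ### The two numbers determine each other -/

/-- Inclusion-exclusion: the double sum cancels except at `S = T = U`. -/
theorem sum_powerset_neg_one_pow_mul_sum_powerset {α : Type*} (g : Finset α → ℤ)
    (U : Finset α) :
    ∑ S ∈ U.powerset, (-1) ^ #S * ∑ T ∈ S.powerset, g T = (-1) ^ #U * g U := by
  classical
  induction U using Finset.induction_on generalizing g with
  | empty => simp
  | insert x U hx ih =>
    have key : ∀ S ∈ U.powerset,
        (-1) ^ #(insert x S) * ∑ T ∈ (insert x S).powerset, g T =
          -((-1) ^ #S * ∑ T ∈ S.powerset, g T) -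
            (-1) ^ #S * ∑ T ∈ S.powerset, g (insert x T) := by
      intro S hS
      have hxS : x ∉ S := fun h => hx (mem_powerset.1 hS h)
      rw [Finset.card_insert_of_notMem hxS, Finset.sum_powerset_insert hxS, pow_succ]
      ring
    rw [Finset.sum_powerset_insert hx, Finset.sum_congr rfl key, Finset.sum_sub_distrib,
      Finset.sum_neg_distrib, ih fun T => g (insert x T), Finset.card_insert_of_notMem hx, pow_succ]
    ring

theorem sum_powerset_neg_one_pow_mul_sum_aNumber (G : SimpleGraph V) (S : Finset V) :
    ∑ T ∈ S.powerset, (-1) ^ #T * ∑ X ∈ T.powerset, (G.inducedOn X).aNumber =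
      (G.inducedOn S).aNumber := by
  rw [sum_powerset_neg_one_pow_mul_sum_powerset (fun X => (G.inducedOn X).aNumber)]
  by_cases hev : (G.inducedOn S).IsEvenGraph
  · rw [(isEvenGraph_inducedOn_iff.1 hev S subset_rfl fun _ _ w hw _ => hw).neg_one_pow, one_mul]
  · rw [aNumber_inducedOn_eq_zero_of_not_isEvenGraph hev, mul_zero]

theorem not_isEvenGraph_of_isOddGraph {S : Finset V} (hS : S.Nonempty)
    (h : (G.inducedOn S).IsOddGraph) : ¬ (G.inducedOn S).IsEvenGraph := by
  obtain ⟨v, hv⟩ := hS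
  intro hev
  exact Nat.not_even_iff_odd.2 (h ((G.inducedOn S).connectedComponentMk ⟨v, hv⟩)) (hev _)

/-- The right side satisfies the recursion of the `b`-number: it vanishes off the odd graphs by
multiplicativity of `a`, and its sums over nonnull odd graphs vanish by inclusion-exclusion. -/
theorem bNumber_inducedOn (G : SimpleGraph V) (S : Finset V) :
    (G.inducedOn S).bNumber = (-1) ^ #S * ∑ T ∈ S.powerset, (G.inducedOn T).aNumber := by
  classical
  induction S using Finset.strongInduction with
  | _ S ih =>
    rcases S.eq_empty_or_nonempty with rfl | hS
    · rw [satisfiesRecursion_bNumber.inducedOn_empty G]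
      simpa using (satisfiesRecursion_aNumber.inducedOn_empty G).symm
    by_cases hodd : (G.inducedOn S).IsOddGraph
    · have hsum := sum_powerset_neg_one_pow_mul_sum_aNumber G S
      rw [aNumber_inducedOn_eq_zero_of_not_isEvenGraph (not_isEvenGraph_of_isOddGraph hS hodd),
        ← Finset.sum_erase_add _ _ (mem_powerset_self S)] at hsum
      rw [satisfiesRecursion_bNumber.inducedOn_eq_neg_sum isoInvariant_isOddGraph G hS hodd,
        Finset.sum_congr rfl fun T hT => ih T (mem_ssubsets.1 hT), Finset.ssubsets]
      linarith
    · rw [satisfiesRecursion_bNumber.inducedOn_eq_zero G hS hodd,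
        sum_aNumber_eq_zero_of_not_isOddGraph hodd, mul_zero]

theorem aNumber_inducedOn (G : SimpleGraph V) (S : Finset V) :
    (G.inducedOn S).aNumber = ∑ T ∈ S.powerset, (G.inducedOn T).bNumber := by
  simp only [bNumber_inducedOn, sum_powerset_neg_one_pow_mul_sum_aNumber]

end SimpleGraph

open SimpleGraph in
theorem mainTheorem3 :
    (∀ (V : Type u) [Fintype V] (G : SimpleGraph V),
      G.bNumber = (-1) ^ Fintype.card V * ∑ S : Finset V, (G.inducedOn S).aNumber ∧
      G.aNumber = ∑ S : Finset V, (G.inducedOn S).bNumber) ∧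
    (∀ (V : Type u) [Fintype V] (G G' : SimpleGraph V),
      (∀ S : Finset V, (G.inducedOn S).aNumber = (G'.inducedOn S).aNumber) ↔
      (∀ S : Finset V, (G.inducedOn S).bNumber = (G'.inducedOn S).bNumber)) := by
  refine ⟨fun V _ G => ⟨?_, ?_⟩, fun V _ G G' => ⟨fun h S => ?_, fun h S => ?_⟩⟩
  · rw [← satisfiesRecursion_bNumber.congr isoInvariant_isOddGraph _ _ _ _ (inducedOnUnivIso G),
      bNumber_inducedOn, Finset.powerset_univ, Finset.card_univ]
  · rw [← satisfiesRecursion_aNumber.congr isoInvariant_isEvenGraph _ _ _ _ (inducedOnUnivIso G),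
      aNumber_inducedOn, Finset.powerset_univ]
  · simp only [bNumber_inducedOn, h]
  · simp only [aNumber_inducedOn, h]
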